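/- Let $\ln\Gamma$ denote the principal branch of the log-Gamma function, i.e. the unique analytic function on the cut plane $\mathbb{C}\setminus(-\infty,0]$ with $\ln\Gamma(x)=\log(\Gamma(x))\in\mathbb{R}$ for every real $x>0$, and let $\log$ be the principal branch of the logarithm. For integers $j,k\ge 1$ and $z\in\mathbb{C}\setminus(-\infty,0]$ put $$T_j(z)=\frac{B_{2j}}{2j(2j-1)z^{2j-1}},$$ where $B_{2j}$ are the Bernoulli numbers, and define the remainder $R_k(z)$ in Stirling's approximation by $$\ln\Gamma(z)=\left(z-\tfrac12\right)\log z-z+\tfrac12\log(2\pi)+\sum_{j=1}^{k-1}T_j(z)+R_k(z).$$ Theorem. Let $z\in\mathbb{C}$ with $z\ne 0$ and $\operatorname{Re} z\ge 0$, and let $k\ge 1$ be an integer with $k\le|z|$. Then $$\left|\frac{R_{k+1}(z)}{T_k(z)}\right|<\frac{(k/|z|)^2}{\pi^2-1}\le\frac{1}{\pi^2-1}<0.113$$ and $$\left|\frac{R_k(z)}{T_k(z)}\right|<1+\frac{(k/|z|)^2}{\pi^2-1}\le\frac{\pi^2}{\pi^2-1}<1.113.$$ -/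

import Mathlib

namespace GammaStirling

/-- The log-Gamma function `ln Γ` on the cut plane `ℂ \ (-∞, 0]`: the integral of `Γ'/Γ` along the
straight segment from `1` to `z`. On the cut plane it is the unique analytic function that agrees
with the real number `log (Γ x)` at every positive real `x`
(see `logGamma_analytic`, `logGamma_ofReal`, `logGamma_unique`). -/
noncomputable def logGamma (z : ℂ) : ℂ :=
  ∫ t in (0 : ℝ)..1, Complex.digamma (1 + (t : ℂ) * (z - 1)) * (z - 1)

/-- The `j`-th term `T_j(z) = B_{2j} / (2j (2j-1) z^{2j-1})`, `j ≥ 1`, of Stirling's series. -/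
noncomputable def T (j : ℕ) (z : ℂ) : ℂ :=
  ((bernoulli (2 * j) : ℚ) : ℂ) / (2 * (j : ℂ) * (2 * (j : ℂ) - 1) * z ^ (2 * j - 1))

/-- The remainder `R_k(z)`, `k ≥ 1`, of Stirling's approximation, defined by
`ln Γ(z) = (z - 1/2) log z - z + (1/2) log (2π) + ∑_{j=1}^{k-1} T_j(z) + R_k(z)`. -/
noncomputable def R (k : ℕ) (z : ℂ) : ℂ :=
  logGamma z - ((z - 1 / 2) * Complex.log z - z + ((1 / 2 * Real.log (2 * Real.pi) : ℝ) : ℂ)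
    + ∑ j ∈ Finset.Icc 1 (k - 1), T j z)

/-! Facts that identify `logGamma` as the principal branch of the log-Gamma function. -/

theorem ne_neg_nat_of_mem_slitPlane {z : ℂ} (hz : z ∈ Complex.slitPlane) (m : ℕ) :
    z ≠ -(m : ℂ) := by
  rintro rfl
  simp only [Complex.mem_slitPlane_iff, Complex.neg_re, Complex.natCast_re, Complex.neg_im,
    Complex.natCast_im, neg_zero, ne_eq, not_true_eq_false, or_false, Left.neg_pos_iff] at hz
  exact absurd hz (not_lt.mpr (Nat.cast_nonneg m))

theorem isPreconnected_slitPlane : IsPreconnected Complex.slitPlane :=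
  (Complex.starConvex_one_slitPlane.isPathConnected
    Complex.one_mem_slitPlane).isConnected.isPreconnected

theorem differentiableOn_Gamma : DifferentiableOn ℂ Complex.Gamma Complex.slitPlane := fun z hz =>
  (Complex.differentiableAt_Gamma z (ne_neg_nat_of_mem_slitPlane hz)).differentiableWithinAt

theorem differentiableOn_digamma : DifferentiableOn ℂ Complex.digamma Complex.slitPlane := by
  have h := differentiableOn_Gamma.deriv Complex.isOpen_slitPlane
  exact h.div differentiableOn_Gamma
    (fun z hz => Complex.Gamma_ne_zero (ne_neg_nat_of_mem_slitPlane hz))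

theorem segment_mem {z : ℂ} (hz : z ∈ Complex.slitPlane) {t : ℝ} (ht : t ∈ Set.Icc (0 : ℝ) 1) :
    1 + (t : ℂ) * (z - 1) ∈ Complex.slitPlane := by
  have := Complex.starConvex_one_slitPlane.add_smul_sub_mem hz ht.1 ht.2
  simpa using this

theorem logGamma_hasDerivAt {z : ℂ} (hz : z ∈ Complex.slitPlane) :
    HasDerivAt logGamma (Complex.digamma z) z := by
  set f := Complex.digamma with hf
  have hfd : ∀ w ∈ Complex.slitPlane, HasDerivAt f (deriv f w) w := fun w hw =>
    (differentiableOn_digamma.differentiableAt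
      (Complex.isOpen_slitPlane.mem_nhds hw)).hasDerivAt
  have hfc : ContinuousOn f Complex.slitPlane := differentiableOn_digamma.continuousOn
  have hfc' : ContinuousOn (deriv f) Complex.slitPlane :=
    (differentiableOn_digamma.deriv Complex.isOpen_slitPlane).continuousOn
  obtain ⟨r, hr, hball⟩ := Metric.nhds_basis_closedBall.mem_iff.mp
    (Complex.isOpen_slitPlane.mem_nhds hz)
  let F : ℂ → ℝ → ℂ := fun w t => f (1 + (t : ℂ) * (w - 1)) * (w - 1)
  let F' : ℂ → ℝ → ℂ := fun w t =>
    deriv f (1 + (t : ℂ) * (w - 1)) * (t : ℂ) * (w - 1) + f (1 + (t : ℂ) * (w - 1))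
  have hmaps : Set.MapsTo (fun p : ℂ × ℝ => 1 + (p.2 : ℂ) * (p.1 - 1))
      (Complex.slitPlane ×ˢ Set.Icc (0 : ℝ) 1) Complex.slitPlane :=
    fun p hp => segment_mem hp.1 hp.2
  have hcont : ContinuousOn (fun p : ℂ × ℝ => 1 + (p.2 : ℂ) * (p.1 - 1))
      (Complex.slitPlane ×ˢ Set.Icc (0 : ℝ) 1) := by fun_prop
  have hF : ContinuousOn (fun p : ℂ × ℝ => F p.1 p.2)
      (Complex.slitPlane ×ˢ Set.Icc (0 : ℝ) 1) :=
    (hfc.comp hcont hmaps).mul (by fun_prop)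
  have hF' : ContinuousOn (fun p : ℂ × ℝ => F' p.1 p.2)
      (Complex.slitPlane ×ˢ Set.Icc (0 : ℝ) 1) :=
    (((hfc'.comp hcont hmaps).mul (by fun_prop)).mul (by fun_prop)).add (hfc.comp hcont hmaps)
  have slice : ∀ G : ℂ → ℝ → ℂ, ContinuousOn (fun p : ℂ × ℝ => G p.1 p.2)
      (Complex.slitPlane ×ˢ Set.Icc (0 : ℝ) 1) → ∀ w ∈ Complex.slitPlane,
      ContinuousOn (G w) (Set.uIcc (0 : ℝ) 1) := by
    intro G hG w hw
    rw [Set.uIcc_of_le zero_le_one]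
    exact hG.comp (f := fun t : ℝ => (w, t)) (by fun_prop) (fun t ht => ⟨hw, ht⟩)
  obtain ⟨C, hC⟩ := ((isCompact_closedBall z r).prod
    (isCompact_Icc (a := (0 : ℝ)) (b := 1))).exists_bound_of_continuousOn
    (hF'.mono (Set.prod_mono_left hball))
  have huI : ∀ t ∈ Set.uIoc (0 : ℝ) 1, t ∈ Set.Icc (0 : ℝ) 1 := fun t ht => by
    rw [Set.uIoc_of_le zero_le_one] at ht
    exact ⟨ht.1.le, ht.2⟩
  have key := intervalIntegral.hasDerivAt_integral_of_dominated_loc_of_deriv_le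
    (μ := MeasureTheory.volume) (a := 0) (b := 1) (F := F) (F' := F') (x₀ := z)
    (s := Metric.closedBall z r) (bound := fun _ => C) (Metric.closedBall_mem_nhds z hr)
    (by
      filter_upwards [Complex.isOpen_slitPlane.mem_nhds hz] with w hw
      exact (slice F hF w hw).intervalIntegrable.def'.aestronglyMeasurable)
    (slice F hF z hz).intervalIntegrable
    (slice F' hF' z hz).intervalIntegrable.def'.aestronglyMeasurable
    (Filter.Eventually.of_forall fun t ht w hw => hC (w, t) ⟨hw, huI t ht⟩)
    intervalIntegrable_const
    (Filter.Eventually.of_forall fun t ht w hw => by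
      have h1 : HasDerivAt (fun w : ℂ => 1 + (t : ℂ) * (w - 1)) (t : ℂ) w := by
        simpa using (((hasDerivAt_id w).sub_const 1).const_mul (t : ℂ)).const_add 1
      have h2 := (hfd _ (segment_mem (hball hw) (huI t ht))).comp w h1
      have h3 := h2.mul ((hasDerivAt_id w).sub_const 1)
      simpa [F, F', Function.comp_def] using! h3)
  have hint : ∫ t in (0 : ℝ)..1, F' z t = f z := by
    have := intervalIntegral.integral_eq_sub_of_hasDerivAt (a := 0) (b := 1)
      (f := fun t : ℝ => (t : ℂ) * f (1 + (t : ℂ) * (z - 1))) (f' := F' z)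
      (fun t ht => by
        rw [Set.uIcc_of_le zero_le_one] at ht
        have h1 : HasDerivAt (fun t : ℝ => 1 + (t : ℂ) * (z - 1)) (z - 1) t := by
          simpa using ((Complex.ofRealCLM.hasDerivAt (x := t)).mul_const (z - 1)).const_add 1
        have h2 := HasDerivAt.scomp t (hfd _ (segment_mem hz ht)) h1
        have h3 := (Complex.ofRealCLM.hasDerivAt (x := t)).mul h2
        convert! h3 using 1
        simp [F']
        ring)
      (slice F' hF' z hz).intervalIntegrable
    simpa using this
  have h := key.2
  rw [hint] at h
  exact h

theorem logGamma_analytic : AnalyticOnNhd ℂ logGamma Complex.slitPlane :=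
  DifferentiableOn.analyticOnNhd
    (fun _ hz => (logGamma_hasDerivAt hz).differentiableAt.differentiableWithinAt)
    Complex.isOpen_slitPlane

theorem logGamma_one : logGamma 1 = 0 := by simp [logGamma]

theorem exp_logGamma {z : ℂ} (hz : z ∈ Complex.slitPlane) :
    Complex.exp (logGamma z) = Complex.Gamma z := by
  have hd : ∀ w ∈ Complex.slitPlane,
      HasDerivAt (fun w => Complex.Gamma w * Complex.exp (-logGamma w)) 0 w := by
    intro w hw
    have h1 := (Complex.differentiableAt_Gamma w (ne_neg_nat_of_mem_slitPlane hw)).hasDerivAt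
    have h2 := h1.mul (logGamma_hasDerivAt hw).neg.cexp
    convert! h2 using 1
    have h0 := Complex.Gamma_ne_zero (ne_neg_nat_of_mem_slitPlane hw)
    rw [Complex.digamma_def, logDeriv_apply]
    field_simp
    ring
  have := Complex.isOpen_slitPlane.eqOn_of_deriv_eq isPreconnected_slitPlane
    (f := fun w => Complex.Gamma w * Complex.exp (-logGamma w)) (g := fun _ => (1 : ℂ))
    (fun w hw => (hd w hw).differentiableAt.differentiableWithinAt)
    (differentiableOn_const _) (fun w hw => by simp [(hd w hw).deriv])
    Complex.one_mem_slitPlane (by simp [logGamma_one]) hz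
  simp only [Complex.exp_neg] at this
  have h0 := Complex.exp_ne_zero (logGamma z)
  field_simp at this
  exact this.symm

theorem logGamma_ofReal {x : ℝ} (hx : 0 < x) :
    logGamma (x : ℂ) = ((Real.log (Real.Gamma x) : ℝ) : ℂ) := by
  have hne : ∀ y : ℝ, 0 < y → ∀ m : ℕ, y ≠ -(m : ℝ) := fun y hy m =>
    (lt_of_le_of_lt (neg_nonpos.mpr (Nat.cast_nonneg m)) hy).ne'
  have hL : ∀ y ∈ Set.Ioi (0 : ℝ),
      HasDerivAt (fun y : ℝ => logGamma (y : ℂ)) (Complex.digamma (y : ℂ)) y := fun y hy =>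
    (logGamma_hasDerivAt (Complex.ofReal_mem_slitPlane.mpr hy)).comp_ofReal
  have hR : ∀ y ∈ Set.Ioi (0 : ℝ),
      HasDerivAt (fun y : ℝ => ((Real.log (Real.Gamma y) : ℝ) : ℂ))
        (Complex.digamma (y : ℂ)) y := by
    intro y hy
    have hG := (Real.differentiableAt_Gamma (hne y hy)).hasDerivAt
    have h1 := (hG.log (Real.Gamma_pos_of_pos hy).ne').ofReal_comp
    have hC := (Complex.differentiableAt_Gamma (y : ℂ) (ne_neg_nat_of_mem_slitPlane
      (Complex.ofReal_mem_slitPlane.mpr hy))).hasDerivAt.comp_ofReal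
    have h2 : deriv Complex.Gamma (y : ℂ) = ((deriv Real.Gamma y : ℝ) : ℂ) := by
      refine hC.unique ?_
      simpa [Complex.Gamma_ofReal] using hG.ofReal_comp
    convert! h1 using 1
    rw [Complex.digamma_def, logDeriv_apply, h2, Complex.Gamma_ofReal]
    push_cast
    rfl
  exact isOpen_Ioi.eqOn_of_deriv_eq isPreconnected_Ioi
    (f := fun y : ℝ => logGamma (y : ℂ)) (g := fun y : ℝ => ((Real.log (Real.Gamma y) : ℝ) : ℂ))
    (fun y hy => (hL y hy).differentiableAt.differentiableWithinAt)
    (fun y hy => (hR y hy).differentiableAt.differentiableWithinAt)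
    (fun y hy => by rw [(hL y hy).deriv, (hR y hy).deriv])
    (Set.mem_Ioi.mpr one_pos) (by simp [logGamma_one]) hx

/-- An analytic function on the cut plane with the real values `log (Γ x)` on the positive axis is
`logGamma`. -/
theorem logGamma_unique {L : ℂ → ℂ} (hL : AnalyticOnNhd ℂ L Complex.slitPlane)
    (hreal : ∀ x : ℝ, 0 < x → L (x : ℂ) = ((Real.log (Real.Gamma x) : ℝ) : ℂ)) :
    Set.EqOn L logGamma Complex.slitPlane := by
  refine hL.eqOn_of_preconnected_of_frequently_eq logGamma_analytic isPreconnected_slitPlane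
    Complex.one_mem_slitPlane ?_
  have ht : Filter.Tendsto (fun x : ℝ => (x : ℂ)) (nhdsWithin 1 {1}ᶜ) (nhdsWithin 1 {1}ᶜ) := by
    refine tendsto_nhdsWithin_iff.mpr ⟨?_, ?_⟩
    · have : Filter.Tendsto (fun x : ℝ => (x : ℂ)) (nhds 1) (nhds ((1 : ℝ) : ℂ)) :=
        Complex.continuous_ofReal.tendsto 1
      rw [Complex.ofReal_one] at this
      exact this.mono_left nhdsWithin_le_nhds
    · filter_upwards [self_mem_nhdsWithin] with x hx
      simpa using hx
  refine ht.frequently (Filter.Eventually.frequently ?_)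
  filter_upwards [mem_nhdsWithin_of_mem_nhds (Ioi_mem_nhds (zero_lt_one (α := ℝ)))] with x hx
  rw [hreal x hx, logGamma_ofReal hx]

end GammaStirling

/-!
The remainder is written in Euler–Maclaurin form. Integrating by parts on unit intervals shows
that `R_2(z) - R_2(z + 1) = -∫₀¹ B_2(u) / (2 (u + z)²) du` for real `z > 0`, and since
`R_2(x + n) → 0` by Stirling's formula, `R_2(x)` is the sum of these integrals over the translates
`x + n`. The sum converges locally uniformly on the cut plane, so by the identity theorem
(`logGamma_unique`) the formula holds for every `z` there. Further integrations by parts give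
(`tendsto_sum_remainderTerm`) `R_{m+1}(z) = -∫₀^∞ B_{2m}({u}) / (2m (u + z)^{2m}) du`.

For `Re z ≥ 0` one has `|u + z|² ≥ u² + |z|²`, and `|B_{2m}({u})| ≤ |B_{2m}|` by the Fourier
series of the Bernoulli polynomials. Hence `|R_{m+1} / T_m| ≤ (2m - 1) 3π/16` for `m ≥ 3`
(`norm_R_succ_le`), a bound that is only linear in `m` but holds for all `m`. To sharpen it at
`m = k ≤ |z|`, put `s_j = |R_j / T_j|`. From `R_j = T_j + R_{j+1}` and
`|T_{j+1} / T_j| ≤ j (j - 1/2) / (π² |z|²)`, which is the monotonicity of `ζ (2j)`, follows the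
recursion

  `s_j ≤ 1 + j (j - 1/2) / (π² k²) · s_{j+1}`.

For `k < j < 2k` its coefficient is less than `4/π² < 1/2.4`, so the linear bound at `j = 2k` is
damped geometrically on the way down to `j = k + 1`, where `s_{k+1}` is at most `π² / (π² - 1)`
plus `0.525 / k`. As `|R_{k+1} / T_k| ≤ (k / |z|)² π⁻² (1 - 1/(2k)) s_{k+1}`, this suffices
(`one_sub_mul_lt`). An explicit majorant carries this out for `k ≥ 10`; for `3 ≤ k ≤ 9` the
recursion is evaluated, and for `k = 1, 2` the exact values of `B_2`, `B_4` and `B_6` enter.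
-/

namespace GammaStirling

/-! ### Bernoulli numbers and the terms of Stirling's series -/

/-- The Fourier series of `B_{2m}(u)` has coefficients of one sign, so it is largest in absolute
value at `u = 0`. -/
theorem abs_bernoulliFun_two_mul_le {m : ℕ} (hm : m ≠ 0) {u : ℝ} (hu : u ∈ Set.Icc (0 : ℝ) 1) :
    |bernoulliFun (2 * m) u| ≤ |((bernoulli (2 * m) : ℚ) : ℝ)| := by
  have key : ∀ {c : ℝ}, 0 < c → ∀ {x y : ℝ}, |(-1) ^ (m + 1) * c * x| ≤ (-1) ^ (m + 1) * c * y →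
      |x| ≤ |y| := by
    intro c hc x y h
    have h' := h.trans (le_abs_self _)
    simp only [abs_mul, abs_pow, abs_neg, abs_one, one_pow, one_mul, abs_of_pos hc] at h'
    exact le_of_mul_le_mul_left h' hc
  have h0 := hasSum_one_div_nat_pow_mul_cos hm (Set.left_mem_Icc.mpr zero_le_one)
  have hu := hasSum_one_div_nat_pow_mul_cos hm hu
  change HasSum _ (_ * bernoulliFun (2 * m) u) at hu
  change HasSum _ (_ * bernoulliFun (2 * m) 0) at h0
  simp only [mul_zero, Real.cos_zero, mul_one, bernoulliFun_eval_zero] at h0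
  rw [mul_div_assoc, mul_div_assoc] at h0 hu
  refine key (c := (2 * Real.pi) ^ (2 * m) / 2 / (2 * m).factorial) (by positivity) ?_
  refine abs_le.mpr ⟨?_, hasSum_le (fun n => ?_) hu h0⟩
  · refine hasSum_le (fun n => ?_) h0.neg hu
    have := mul_le_mul_of_nonneg_left (Real.neg_one_le_cos (2 * Real.pi * n * u))
      (by positivity : (0:ℝ) ≤ 1 / (n : ℝ) ^ (2 * m))
    linarith
  · have := mul_le_mul_of_nonneg_left (Real.cos_le_one (2 * Real.pi * n * u))
      (by positivity : (0:ℝ) ≤ 1 / (n : ℝ) ^ (2 * m))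
    linarith

theorem hasSum_zeta_abs_bernoulli {m : ℕ} (hm : m ≠ 0) :
    HasSum (fun n : ℕ => 1 / (n : ℝ) ^ (2 * m))
      ((2 * Real.pi) ^ (2 * m) / (2 * (2 * m).factorial) * |((bernoulli (2 * m) : ℚ) : ℝ)|) := by
  have h := hasSum_zeta_nat hm
  have h2 : (2 : ℝ) ^ (2 * m) = 2 * 2 ^ (2 * m - 1) := by
    rw [← pow_succ']; congr 1; omega
  have e : (-1 : ℝ) ^ (m + 1) * (2 : ℝ) ^ (2 * m - 1) * Real.pi ^ (2 * m) *
        bernoulli (2 * m) / (2 * m).factorial = (2 * Real.pi) ^ (2 * m) / (2 * (2 * m).factorial) *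
        ((-1 : ℝ) ^ (m + 1) * bernoulli (2 * m)) := by
    rw [mul_pow, h2]; field_simp
  rw [e] at h
  have h0 := h.nonneg (fun n => by positivity)
  have h1 := nonneg_of_mul_nonneg_right h0 (by positivity)
  rwa [← abs_of_nonneg h1, abs_mul, abs_pow, abs_neg, abs_one, one_pow, one_mul] at h

theorem bernoulli_two_mul_ne_zero {m : ℕ} (hm : m ≠ 0) : bernoulli (2 * m) ≠ 0 := by
  intro h0
  have h := hasSum_zeta_abs_bernoulli hm
  have := le_hasSum h 1 (fun n _ => by positivity)
  simp [h0] at this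
  linarith

/-- The bound on consecutive Bernoulli numbers that expresses `ζ (2m + 2) ≤ ζ (2m)`. -/
theorem abs_bernoulli_two_mul_succ_le {m : ℕ} (hm : m ≠ 0) :
    |((bernoulli (2 * (m + 1)) : ℚ) : ℝ)| ≤
      (2 * m + 2) * (2 * m + 1) / (2 * Real.pi) ^ 2 * |((bernoulli (2 * m) : ℚ) : ℝ)| := by
  have h := hasSum_le (fun n => ?_) (hasSum_zeta_abs_bernoulli m.succ_ne_zero)
    (hasSum_zeta_abs_bernoulli hm)
  · have e : (2 * (m + 1)).factorial = (2 * m + 2) * (2 * m + 1) * (2 * m).factorial := by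
      rw [show 2 * (m + 1) = 2 * m + 1 + 1 by ring, Nat.factorial_succ, Nat.factorial_succ]; ring
    rw [Nat.succ_eq_add_one, e, show 2 * (m + 1) = 2 * m + 2 by ring, pow_add] at h
    push_cast at h
    rw [show 2 * (m + 1) = 2 * m + 2 by ring]
    have hpi := Real.pi_pos
    rw [div_mul_eq_mul_div, le_div_iff₀ (by positivity)]
    have hc : (0 : ℝ) < (2 * Real.pi) ^ (2 * m) / (2 * ((2 * m + 2) * (2 * m + 1) *
      (2 * m).factorial)) := by positivity
    refine le_of_mul_le_mul_left ?_ hc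
    convert! h using 1
    · ring
    · field_simp
  · rcases Nat.eq_zero_or_pos n with rfl | hn
    · simp [hm]
    · have hn' : (1 : ℝ) ≤ n := by exact_mod_cast hn
      exact one_div_le_one_div_of_le (by positivity) (pow_le_pow_right₀ hn' (by simp))

theorem bernoulli_four : bernoulli 4 = -1 / 30 := by
  rw [bernoulli_eq_bernoulli'_of_ne_one (by norm_num), bernoulli'_four]

theorem bernoulli_six : bernoulli 6 = 1 / 42 := by
  rw [bernoulli_eq_bernoulli'_of_ne_one (by norm_num), bernoulli'_def]
  have h5 : bernoulli' 5 = 0 := bernoulli'_eq_zero_of_odd (by decide) (by norm_num)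
  have : Nat.choose 6 4 = 15 := by decide
  have : Nat.choose 6 2 = 15 := by decide
  norm_num [Finset.sum_range_succ, h5, *]

theorem norm_T {j : ℕ} (hj : j ≠ 0) (z : ℂ) :
    ‖T j z‖ = |((bernoulli (2 * j) : ℚ) : ℝ)| / (2 * j * (2 * j - 1) * ‖z‖ ^ (2 * j - 1)) := by
  have h1 : (1 : ℝ) ≤ j := by exact_mod_cast Nat.one_le_iff_ne_zero.mpr hj
  have h2 : ‖(2 * (j : ℂ) - 1)‖ = 2 * j - 1 := by
    rw [show (2 * (j : ℂ) - 1) = ((2 * j - 1 : ℝ) : ℂ) by push_cast; ring, Complex.norm_real,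
      Real.norm_of_nonneg (by linarith)]
  rw [T, norm_div, norm_mul, norm_mul, norm_mul, norm_pow, h2, ← Complex.ofReal_ratCast,
    Complex.norm_real, Real.norm_eq_abs]
  simp

theorem T_one (z : ℂ) : T 1 z = 12⁻¹ * z⁻¹ := by
  simp [T]
  ring

theorem T_ne_zero {j : ℕ} (hj : j ≠ 0) {z : ℂ} (hz : z ≠ 0) : T j z ≠ 0 := by
  have h1 : (1 : ℝ) ≤ j := by exact_mod_cast Nat.one_le_iff_ne_zero.mpr hj
  have h2 : (0 : ℝ) < 2 * j - 1 := by linarith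
  have h3 : (0 : ℝ) < |((bernoulli (2 * j) : ℚ) : ℝ)| :=
    abs_pos.mpr (by exact_mod_cast bernoulli_two_mul_ne_zero hj)
  rw [← norm_pos_iff, norm_T hj]
  have := norm_pos_iff.mpr hz
  positivity

theorem norm_T_succ_le {j : ℕ} (hj : j ≠ 0) {z : ℂ} (hz : z ≠ 0) :
    ‖T (j + 1) z‖ ≤ j * (j - 1 / 2) / (Real.pi ^ 2 * ‖z‖ ^ 2) * ‖T j z‖ := by
  have h1 : (1 : ℝ) ≤ j := by exact_mod_cast Nat.one_le_iff_ne_zero.mpr hj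
  have h2 : (0 : ℝ) < 2 * j - 1 := by linarith
  have hr := norm_pos_iff.mpr hz
  have hp := Real.pi_pos
  have e : ‖z‖ ^ (2 * j + 1) = ‖z‖ ^ (2 * j - 1) * ‖z‖ ^ 2 := by
    rw [← pow_add]; congr 1; omega
  rw [norm_T hj, norm_T j.succ_ne_zero, show 2 * (j + 1) - 1 = 2 * j + 1 by omega, e,
    div_le_iff₀ (by push_cast; ring_nf; positivity)]
  refine (abs_bernoulli_two_mul_succ_le hj).trans (le_of_eq ?_)
  push_cast
  have : (2 * (j : ℝ) - 1) ≠ 0 := h2.ne'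
  field_simp
  ring

theorem norm_T_two (z : ℂ) : ‖T 2 z‖ = 1 / 30 / ‖z‖ ^ 2 * ‖T 1 z‖ := by
  rw [norm_T (by norm_num), norm_T (by norm_num)]
  norm_num [bernoulli_four, bernoulli_two, abs_of_pos]
  by_cases h : ‖z‖ = 0
  · simp [h]
  · field_simp; norm_num

theorem norm_T_three (z : ℂ) : ‖T 3 z‖ = 2 / 7 / ‖z‖ ^ 2 * ‖T 2 z‖ := by
  rw [norm_T (by norm_num), norm_T (by norm_num)]
  norm_num [bernoulli_four, bernoulli_six, abs_of_pos]
  by_cases h : ‖z‖ = 0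
  · simp [h]
  · field_simp; norm_num

section Remainder

open Filter Topology Complex

/-! ### The remainder over a unit interval -/

/-- The contribution `-∫₀¹ B_{2m}(u) / (2m (u + w)^{2m}) du` of the unit interval starting at `w`
to the remainder of Stirling's series: `R_{m+1}(z)` is the sum of these over `w = z, z + 1, …`. -/
noncomputable def remainderTerm (m : ℕ) (w : ℂ) : ℂ :=
  ∫ u in (0 : ℝ)..1, -((bernoulliFun (2 * m) u : ℝ) : ℂ) / (2 * m * (u + w) ^ (2 * m))

theorem add_mem_slitPlane {w : ℂ} (hw : w ∈ slitPlane) {u : ℝ} (hu : 0 ≤ u) :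
    (u : ℂ) + w ∈ slitPlane := by
  rw [mem_slitPlane_iff] at hw ⊢
  rcases hw with h | h
  · left; simp; linarith
  · right; simpa using h

theorem continuousOn_remainderTerm_integrand (m : ℕ) {w : ℂ} (hw : w ∈ slitPlane) :
    ContinuousOn (fun u : ℝ => -((bernoulliFun (2 * m) u : ℝ) : ℂ) / (2 * m * (u + w) ^ (2 * m)))
      (Set.uIcc 0 1) := by
  rcases eq_or_ne m 0 with rfl | hm
  · simp [continuousOn_const]
  have hm' : (m : ℂ) ≠ 0 := by exact_mod_cast hm
  refine ContinuousOn.div ?_ (by fun_prop) fun u hu => ?_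
  · exact (continuous_ofReal.comp (continuous_bernoulliFun _)).neg.continuousOn
  · rw [Set.uIcc_of_le zero_le_one] at hu
    have := slitPlane_ne_zero (add_mem_slitPlane hw hu.1)
    simp [hm', this]

theorem hasDerivAt_ofReal_add (w : ℂ) (u : ℝ) : HasDerivAt (fun u : ℝ => (u : ℂ) + w) 1 u := by
  simpa using (hasDerivAt_id u).ofReal_comp.add_const w

theorem hasDerivAt_bernoulliFun_succ (n : ℕ) (u : ℝ) :
    HasDerivAt (fun u : ℝ => ((bernoulliFun (n + 1) u : ℝ) : ℂ))
      ((n + 1) * ((bernoulliFun n u : ℝ) : ℂ)) u := by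
  simpa using (hasDerivAt_bernoulliFun (n + 1) u).ofReal_comp

theorem hasDerivAt_bernoulliFun_div_pow (n l : ℕ) {c w : ℂ} {u : ℝ} (h0 : (u : ℂ) + w ≠ 0) :
    HasDerivAt (fun u : ℝ => ((bernoulliFun (n + 1) u : ℝ) : ℂ) / (c * (u + w) ^ l))
      ((n + 1) * ((bernoulliFun n u : ℝ) : ℂ) / (c * (u + w) ^ l) -
        l * ((bernoulliFun (n + 1) u : ℝ) : ℂ) / (c * (u + w) ^ (l + 1))) u := by
  have h1 := ((hasDerivAt_ofReal_add w u).pow l).inv (pow_ne_zero l h0)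
  have h2 := ((hasDerivAt_bernoulliFun_succ n u).mul h1).div_const c
  convert! h2 using 1
  · ext v
    simp only [Pi.mul_apply, Pi.inv_apply, Pi.pow_apply]
    rw [mul_comm c, ← div_div, div_eq_mul_inv _ ((_ : ℂ) ^ l)]
  · simp only [Pi.inv_apply, Pi.pow_apply]
    rcases eq_or_ne c 0 with rfl | hc
    · simp
    rcases l with _ | l
    · simp
    · rw [Nat.add_sub_cancel]
      generalize (u : ℂ) + w = v at h0 ⊢
      field_simp
      ring

theorem bernoulliFun_odd_eq_zero {m : ℕ} (hm : m ≠ 0) :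
    bernoulliFun (2 * m + 1) 0 = 0 ∧ bernoulliFun (2 * m + 1) 1 = 0 := by
  have h : bernoulliFun (2 * m + 1) 0 = 0 := by
    rw [bernoulliFun_eval_zero, bernoulli_eq_zero_of_odd (by simp) (by omega), Rat.cast_zero]
  exact ⟨h, by rw [bernoulliFun_endpoints_eq_of_ne_one (by omega), h]⟩

/-- Two integrations by parts raise the index `m` and split off the difference of Stirling terms
that telescopes along `w, w + 1, …`; the odd Bernoulli polynomials vanish at both ends. -/
theorem remainderTerm_succ {m : ℕ} (hm : m ≠ 0) {w : ℂ} (hw : w ∈ slitPlane) :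
    remainderTerm (m + 1) w = remainderTerm m w - (T (m + 1) w - T (m + 1) (w + 1)) := by
  have hm' : (m : ℂ) ≠ 0 := by exact_mod_cast hm
  have h1 : (2 * m + 1 : ℂ) ≠ 0 := by exact_mod_cast (2 * m).succ_ne_zero
  have h2 : (2 * m + 2 : ℂ) ≠ 0 := by exact_mod_cast (2 * m + 1).succ_ne_zero
  have key := intervalIntegral.integral_eq_sub_of_hasDerivAt (a := 0) (b := 1)
    (f := fun u : ℝ => ((bernoulliFun (2 * m + 1) u : ℝ) : ℂ) /
        ((2 * m + 1) * (2 * m) * (u + w) ^ (2 * m)) +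
      ((bernoulliFun (2 * m + 1 + 1) u : ℝ) : ℂ) /
        ((2 * m + 2) * (2 * m + 1) * (u + w) ^ (2 * m + 1)))
    (f' := fun u : ℝ => -((bernoulliFun (2 * (m + 1)) u : ℝ) : ℂ) /
        (2 * (m + 1 : ℕ) * (u + w) ^ (2 * (m + 1))) -
      -((bernoulliFun (2 * m) u : ℝ) : ℂ) / (2 * m * (u + w) ^ (2 * m))) ?_ ?_
  · rw [intervalIntegral.integral_sub (continuousOn_remainderTerm_integrand _ hw).intervalIntegrable
      (continuousOn_remainderTerm_integrand _ hw).intervalIntegrable] at key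
    obtain ⟨e0, e1⟩ := bernoulliFun_odd_eq_zero hm
    have e2 := bernoulliFun_endpoints_eq_of_ne_one (k := 2 * m + 1 + 1) (by omega)
    rw [e0, e1, e2, bernoulliFun_eval_zero] at key
    have e3 : 2 * (m + 1) - 1 = 2 * m + 1 := by omega
    have hT : ∀ v : ℂ, T (m + 1) v = ((bernoulli (2 * m + 1 + 1) : ℚ) : ℂ) /
        ((2 * m + 2) * (2 * m + 1) * v ^ (2 * m + 1)) := by
      intro v
      rw [T, e3]
      push_cast
      congr 2
      ring
    rw [hT, hT]
    simp only [ofReal_zero, zero_div, zero_add, ofReal_one, ofReal_ratCast] at key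
    rw [add_comm w 1]
    change remainderTerm (m + 1) w - remainderTerm m w = _ at key
    linear_combination key
  · intro u hu
    rw [Set.uIcc_of_le zero_le_one] at hu
    have h0 := slitPlane_ne_zero (add_mem_slitPlane hw hu.1)
    convert! (hasDerivAt_bernoulliFun_div_pow (2 * m) (2 * m) (c := (2 * m + 1) * (2 * m)) h0).add
      (hasDerivAt_bernoulliFun_div_pow (2 * m + 1) (2 * m + 1)
        (c := (2 * m + 2) * (2 * m + 1)) h0) using 1
    rw [show 2 * (m + 1) = 2 * m + 1 + 1 by ring]
    generalize (u : ℂ) + w = v at h0 ⊢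
    push_cast
    field_simp
    ring
  · exact ((continuousOn_remainderTerm_integrand _ hw).sub
      (continuousOn_remainderTerm_integrand _ hw)).intervalIntegrable

/-- For `m = 1` the integral is elementary. The closed form shows both that it is the defect of
Stirling's formula under `w ↦ w + 1` and that it is analytic in `w`. -/
theorem remainderTerm_one {w : ℂ} (hw : w ∈ slitPlane) :
    remainderTerm 1 w = (w + 1 / 2) * (log (w + 1) - log w) - 1 - (T 1 w - T 1 (w + 1)) := by
  -- the index `2` is written `0 + 1 + 1` to match `hasDerivAt_bernoulliFun_succ`
  have key := intervalIntegral.integral_eq_sub_of_hasDerivAt (a := 0) (b := 1)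
    (f := fun u : ℝ => ((bernoulliFun (0 + 1 + 1) u : ℝ) : ℂ) / (2 * (u + w)) - u +
      (w + 1 / 2) * log (u + w))
    (f' := fun u : ℝ => -((bernoulliFun (2 * 1) u : ℝ) : ℂ) /
        (2 * (1 : ℕ) * (u + w) ^ (2 * 1))) ?_ ?_
  · rw [remainderTerm, key]
    simp [T, add_comm w 1]
    rw [show (2 : ℂ) - 1 = 1 by norm_num]
    ring
  · intro u hu
    rw [Set.uIcc_of_le zero_le_one] at hu
    have hs := add_mem_slitPlane hw hu.1
    have h0 := slitPlane_ne_zero hs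
    have hd := hasDerivAt_ofReal_add w u
    have d1 := (hasDerivAt_bernoulliFun_succ (0 + 1) u).div (hd.const_mul 2) (by simp [h0])
    have d2 := (hd.clog_real hs).const_mul (w + 1 / 2)
    convert! (d1.sub (hasDerivAt_id u).ofReal_comp).add d2 using 1
    simp
    field_simp
    ring
  · exact (continuousOn_remainderTerm_integrand 1 hw).intervalIntegrable

theorem R_succ {k : ℕ} (hk : k ≠ 0) (z : ℂ) : R k z = T k z + R (k + 1) z := by
  obtain ⟨k, rfl⟩ := Nat.exists_eq_succ_of_ne_zero hk
  simp only [R, Nat.succ_eq_add_one, Nat.add_sub_cancel]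
  rw [Finset.sum_Icc_succ_top (by omega)]
  ring

theorem add_natCast_mem_slitPlane {w : ℂ} (hw : w ∈ slitPlane) (n : ℕ) : w + n ∈ slitPlane := by
  have := add_mem_slitPlane hw (u := n) (by positivity)
  rwa [add_comm, ofReal_natCast] at this

theorem tendsto_T_add_natCast {j : ℕ} (hj : j ≠ 0) (z : ℂ) :
    Tendsto (fun n : ℕ => T j (z + n)) atTop (𝓝 0) := by
  have h1 : Tendsto (fun n : ℕ => ‖z + n‖) atTop atTop := by
    refine tendsto_atTop_mono (f := fun n : ℕ => (n : ℝ) - ‖z‖) (fun n => ?_)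
      (tendsto_atTop_add_const_right _ _ tendsto_natCast_atTop_atTop)
    have := norm_sub_norm_le (n : ℂ) (-z)
    rw [norm_neg, sub_neg_eq_add, add_comm (n : ℂ), norm_natCast] at this
    exact this
  rw [tendsto_zero_iff_norm_tendsto_zero]
  simp_rw [norm_T hj, ← div_div]
  exact ((tendsto_pow_atTop (by omega)).comp h1).const_div_atTop _

/-! ### The remainder on the positive real axis -/

/-- Stirling's formula along `x, x + 1, …`, obtained by comparing Euler's limit for `Γ x` with
Stirling's formula for factorials. -/
theorem tendsto_log_Gamma_sub_stirling {x : ℝ} (hx : 0 < x) :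
    Tendsto (fun n : ℕ => Real.log (Real.Gamma (x + n)) - ((x + n - 1 / 2) * Real.log (x + n) -
      (x + n) + 1 / 2 * Real.log (2 * Real.pi))) atTop (𝓝 0) := by
  rw [← tendsto_add_atTop_iff_nat 1]
  have hG : ∀ n : ℕ, Real.log (Real.Gamma (x + n)) =
      Real.log (Real.Gamma x) + ∑ m ∈ Finset.range n, Real.log (x + m) := by
    intro n
    induction n with
    | zero => simp
    | succ n ih =>
      have hp : 0 < x + n := by positivity
      push_cast
      rw [← add_assoc, Real.Gamma_add_one hp.ne',
        Real.log_mul hp.ne' (Real.Gamma_pos_of_pos hp).ne', ih, Finset.sum_range_succ]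
      ring
  have h1 := (Real.BohrMollerup.tendsto_log_gamma hx).const_sub (Real.log (Real.Gamma x))
  have h2 := ((Stirling.tendsto_stirlingSeq_sqrt_pi.log
    (by positivity)).sub_const (Real.log √Real.pi))
  have h3 := (Real.tendsto_mul_log_one_add_div_atTop (x + 1)).comp tendsto_natCast_atTop_atTop
  have h4 : Tendsto (fun n : ℕ => Real.log (1 + (x + 1) / n)) atTop (𝓝 0) := by
    have := ((tendsto_const_div_atTop_nhds_zero_nat (x + 1)).const_add 1).log (by norm_num)
    simpa using this
  have h5 := ((h1.add h2).add (h3.const_sub (x + 1))).sub (h4.const_mul (x + 1 / 2))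
  simp only [sub_self, mul_zero, add_zero] at h5
  refine h5.congr' ?_
  filter_upwards [eventually_gt_atTop 0] with n hn
  have hn' : (0 : ℝ) < n := by exact_mod_cast hn
  have e1 : Real.log (1 + (x + 1) / n) = Real.log (x + (n + 1 : ℕ)) - Real.log n := by
    rw [← Real.log_div (by positivity) hn'.ne']
    congr 1
    push_cast
    field_simp
    ring
  rw [hG, Real.BohrMollerup.logGammaSeq, Stirling.log_stirlingSeq_formula, Function.comp_apply, e1,
    Real.log_sqrt Real.pi_pos.le, Real.log_mul two_ne_zero hn'.ne',
    Real.log_mul two_ne_zero Real.pi_ne_zero, Real.log_div hn'.ne' (Real.exp_ne_zero _),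
    Real.log_exp]
  push_cast
  ring

theorem tendsto_R_two_add_natCast {x : ℝ} (hx : 0 < x) :
    Tendsto (fun n : ℕ => R 2 ((x : ℂ) + n)) atTop (𝓝 0) := by
  have h := ((continuous_ofReal.tendsto 0).comp (tendsto_log_Gamma_sub_stirling hx)).sub
    (tendsto_T_add_natCast one_ne_zero (x : ℂ))
  rw [ofReal_zero, sub_zero] at h
  refine h.congr fun n => ?_
  have hp : 0 < x + n := by positivity
  have e : (x : ℂ) + n = ((x + n : ℝ) : ℂ) := by push_cast; rfl
  rw [R, e, logGamma_ofReal hp, ← ofReal_log hp.le]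
  simp
  ring

theorem R_two_sub {x : ℝ} (hx : 0 < x) : R 2 (x : ℂ) - R 2 (x + 1) = remainderTerm 1 x := by
  have hp : 0 < x + 1 := by positivity
  have e : (x : ℂ) + 1 = ((x + 1 : ℝ) : ℂ) := by push_cast; rfl
  rw [remainderTerm_one (ofReal_mem_slitPlane.mpr hx), e, R, R, logGamma_ofReal hp,
    logGamma_ofReal hx,
    ← ofReal_log hp.le, ← ofReal_log hx.le, Real.Gamma_add_one hx.ne',
    Real.log_mul hx.ne' (Real.Gamma_pos_of_pos hx).ne']
  simp
  ring

theorem tendsto_sum_remainderTerm_one_ofReal {x : ℝ} (hx : 0 < x) :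
    Tendsto (fun N : ℕ => ∑ n ∈ Finset.range N, remainderTerm 1 ((x : ℂ) + n)) atTop
      (𝓝 (R 2 x)) := by
  have h := (tendsto_R_two_add_natCast hx).const_sub (R 2 x)
  rw [sub_zero] at h
  refine h.congr fun N => ?_
  have h2 := Finset.sum_range_sub' (fun n : ℕ => R 2 ((x : ℂ) + n)) N
  rw [Nat.cast_zero, add_zero] at h2
  rw [← h2]
  refine Finset.sum_congr rfl fun n _ => ?_
  have := R_two_sub (x := x + n) (by positivity)
  push_cast at this
  rw [← this, Nat.cast_succ, add_assoc]

/-! ### Continuation of the remainder formula to the cut plane -/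

/-- Locally uniformly in the cut plane, the distance from `z` to `-s` grows at least linearly in
`s ≥ 0`. -/
theorem exists_mul_one_add_le_norm {z₀ : ℂ} (hz₀ : z₀ ∈ slitPlane) :
    ∃ ε > 0, ∃ U, IsOpen U ∧ z₀ ∈ U ∧ U ⊆ slitPlane ∧
      ∀ z ∈ U, ∀ s : ℝ, 0 ≤ s → ε * (1 + s) ≤ ‖(s : ℂ) + z‖ := by
  obtain ⟨r, hr, hball⟩ := Metric.isOpen_iff.mp isOpen_slitPlane z₀ hz₀
  -- the distance is at least `r` because `-s` is not in the cut plane, and at least `s - ‖z₀‖`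
  have hd : 0 < 1 + ‖z₀‖ + r := by positivity
  have key : ∀ s : ℝ, 0 ≤ s → r / (1 + ‖z₀‖ + r) * (1 + s) ≤ ‖(s : ℂ) + z₀‖ := by
    intro s hs
    rw [div_mul_eq_mul_div, div_le_iff₀ hd]
    have h1 : r ≤ ‖(s : ℂ) + z₀‖ := by
      by_contra! h
      have hmem : -(s : ℂ) ∈ slitPlane := hball (by
        rw [Metric.mem_ball, dist_eq, ← norm_neg]
        convert! h using 2
        ring)
      rw [mem_slitPlane_iff] at hmem
      simp at hmem
      linarith
    have h2 : s - ‖z₀‖ ≤ ‖(s : ℂ) + z₀‖ := by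
      have := norm_sub_norm_le (s : ℂ) (-z₀)
      rwa [norm_neg, sub_neg_eq_add, norm_real, Real.norm_of_nonneg hs] at this
    have := norm_nonneg z₀
    nlinarith
  set ε := r / (1 + ‖z₀‖ + r) with hε
  have hε0 : 0 < ε := by positivity
  refine ⟨ε / 2, by positivity, Metric.ball z₀ (ε / 2) ∩ slitPlane,
    Metric.isOpen_ball.inter isOpen_slitPlane, ⟨Metric.mem_ball_self (by positivity), hz₀⟩,
    Set.inter_subset_right, fun z hz s hs => ?_⟩
  have h1 := key s hs
  have h2 : ‖z₀ - z‖ < ε / 2 := by rw [← dist_eq, dist_comm]; exact hz.1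
  have h3 := norm_add_le ((s : ℂ) + z) (z₀ - z)
  rw [show (s : ℂ) + z + (z₀ - z) = s + z₀ by ring] at h3
  nlinarith

theorem norm_remainderTerm_integrand_le {m : ℕ} (hm : m ≠ 0) (w : ℂ) {u : ℝ}
    (hu : u ∈ Set.Icc (0 : ℝ) 1) :
    ‖-((bernoulliFun (2 * m) u : ℝ) : ℂ) / (2 * m * (u + w) ^ (2 * m))‖ ≤
      |((bernoulli (2 * m) : ℚ) : ℝ)| / (2 * m) * (1 / ‖(u : ℂ) + w‖ ^ (2 * m)) := by
  rw [norm_div, norm_neg, norm_real, Real.norm_eq_abs, norm_mul, norm_mul, norm_pow, norm_natCast,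
    Complex.norm_ofNat, div_mul_div_comm, mul_one]
  exact div_le_div_of_nonneg_right (abs_bernoulliFun_two_mul_le hm hu) (by positivity)

theorem norm_remainderTerm_one_le {w : ℂ} {δ : ℝ} (hδ : 0 < δ)
    (h : ∀ u ∈ Set.Icc (0 : ℝ) 1, δ ≤ ‖(u : ℂ) + w‖) : ‖remainderTerm 1 w‖ ≤ 1 / δ ^ 2 := by
  have := intervalIntegral.norm_integral_le_of_norm_le_const (a := (0 : ℝ)) (b := 1)
    (C := 1 / δ ^ 2)
    (f := fun u : ℝ => -((bernoulliFun (2 * 1) u : ℝ) : ℂ) / (2 * (1 : ℕ) * (u + w) ^ (2 * 1)))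
    fun u hu => by
      rw [Set.uIoc_of_le zero_le_one] at hu
      have hu' : u ∈ Set.Icc (0 : ℝ) 1 := ⟨hu.1.le, hu.2⟩
      refine (norm_remainderTerm_integrand_le one_ne_zero w hu').trans ?_
      rw [← one_mul (1 / δ ^ 2)]
      refine mul_le_mul ?_ ?_ (by positivity) zero_le_one
      · norm_num [bernoulli_two, abs_of_pos]
      · exact one_div_le_one_div_of_le (by positivity) (pow_le_pow_left₀ hδ.le (h u hu') 2)
  simpa [remainderTerm] using this

theorem differentiableOn_remainderTerm_one : DifferentiableOn ℂ (remainderTerm 1) slitPlane := by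
  refine DifferentiableOn.congr (f := fun w => (w + 1 / 2) * (log (w + 1) - log w) - 1 -
    (T 1 w - T 1 (w + 1))) ?_ fun w hw => remainderTerm_one hw
  intro w hw
  have h1 : w + 1 ∈ slitPlane := by simpa using add_natCast_mem_slitPlane hw 1
  have := slitPlane_ne_zero h1
  have := slitPlane_ne_zero hw
  refine DifferentiableAt.differentiableWithinAt ?_
  simp_rw [T_one]
  have d1 : DifferentiableAt ℂ (fun v : ℂ => log (v + 1)) w :=
    DifferentiableAt.clog (by fun_prop) h1
  have d2 : DifferentiableAt ℂ (fun v : ℂ => log v) w := DifferentiableAt.clog (by fun_prop) hw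
  have d3 : DifferentiableAt ℂ (fun v : ℂ => (v + 1)⁻¹) w :=
    DifferentiableAt.inv (by fun_prop) (by assumption)
  have d4 : DifferentiableAt ℂ (fun v : ℂ => v⁻¹) w :=
    DifferentiableAt.inv (by fun_prop) (by assumption)
  fun_prop

theorem exists_summable_bound_remainderTerm_one {z₀ : ℂ} (hz₀ : z₀ ∈ slitPlane) :
    ∃ U, IsOpen U ∧ z₀ ∈ U ∧ U ⊆ slitPlane ∧ ∃ b : ℕ → ℝ, Summable b ∧
      ∀ n : ℕ, ∀ z ∈ U, ‖remainderTerm 1 (z + n)‖ ≤ b n := by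
  obtain ⟨ε, hε, U, hU, hz, hUs, h⟩ := exists_mul_one_add_le_norm hz₀
  refine ⟨U, hU, hz, hUs, fun n => 1 / ε ^ 2 * (1 / (((n + 1 : ℕ) : ℝ) ^ 2)), ?_, fun n z hzU => ?_⟩
  · exact ((summable_nat_add_iff 1).mpr (Real.summable_one_div_nat_pow.mpr one_lt_two)).mul_left _
  · have := norm_remainderTerm_one_le (w := z + n) (δ := ε * (n + 1 : ℕ)) (by positivity)
      fun u hu => by
      have := h z hzU (u + n) (by have := hu.1; positivity)
      rw [show (u : ℂ) + (z + n) = ((u + n : ℝ) : ℂ) + z by push_cast; ring]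
      refine le_trans ?_ this
      push_cast
      refine mul_le_mul_of_nonneg_left ?_ hε.le
      linarith [hu.1]
    refine this.trans (le_of_eq ?_)
    simp only
    rw [mul_pow, div_mul_div_comm, one_mul]

theorem differentiableOn_tsum_remainderTerm_one :
    DifferentiableOn ℂ (fun z => ∑' n : ℕ, remainderTerm 1 (z + n)) slitPlane := by
  intro z₀ hz₀
  obtain ⟨U, hU, hz, hUs, b, hb, h⟩ := exists_summable_bound_remainderTerm_one hz₀
  refine ((differentiableOn_tsum_of_summable_norm hb (fun n => ?_) hU h).differentiableAt
    (hU.mem_nhds hz)).differentiableWithinAt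
  exact differentiableOn_remainderTerm_one.comp (by fun_prop) fun z hz =>
    add_natCast_mem_slitPlane (hUs hz) n

theorem summable_remainderTerm_one {z : ℂ} (hz : z ∈ slitPlane) :
    Summable fun n : ℕ => remainderTerm 1 (z + n) := by
  obtain ⟨U, hU, hzU, hUs, b, hb, h⟩ := exists_summable_bound_remainderTerm_one hz
  exact Summable.of_norm_bounded hb fun n => h n z hzU

/-- Both sides are analytic on the cut plane and agree on the positive real axis. -/
theorem R_two_eq_tsum {z : ℂ} (hz : z ∈ slitPlane) : R 2 z = ∑' n : ℕ, remainderTerm 1 (z + n) := by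
  have hL := logGamma_unique (L := fun z => (∑' n : ℕ, remainderTerm 1 (z + n)) +
    ((z - 1 / 2) * log z - z + ((1 / 2 * Real.log (2 * Real.pi) : ℝ) : ℂ) +
      ∑ j ∈ Finset.Icc 1 (2 - 1), T j z)) ?_ ?_ hz
  · rw [R, ← hL]
    ring
  · refine DifferentiableOn.analyticOnNhd ?_ isOpen_slitPlane
    refine differentiableOn_tsum_remainderTerm_one.add ?_
    intro w hw
    have := slitPlane_ne_zero hw
    refine DifferentiableAt.differentiableWithinAt ?_
    simp only [Nat.add_one_sub_one, Finset.Icc_self, Finset.sum_singleton, T_one]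
    have d2 : DifferentiableAt ℂ (fun v : ℂ => log v) w := DifferentiableAt.clog (by fun_prop) hw
    have d4 : DifferentiableAt ℂ (fun v : ℂ => v⁻¹) w :=
      DifferentiableAt.inv (by fun_prop) (by assumption)
    fun_prop
  · intro x hx
    have h1 := (summable_remainderTerm_one (ofReal_mem_slitPlane.mpr hx)).hasSum.tendsto_sum_nat
    have h2 := tendsto_nhds_unique h1 (tendsto_sum_remainderTerm_one_ofReal hx)
    simp only [h2, R, ← logGamma_ofReal hx]
    ring

/-- Euler–Maclaurin representation of the remainder, valid in the whole cut plane. -/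
theorem tendsto_sum_remainderTerm {m : ℕ} (hm : 1 ≤ m) {z : ℂ} (hz : z ∈ slitPlane) :
    Tendsto (fun N : ℕ => ∑ n ∈ Finset.range N, remainderTerm m (z + n)) atTop
      (𝓝 (R (m + 1) z)) := by
  induction m, hm using Nat.le_induction with
  | base =>
    rw [R_two_eq_tsum hz]
    exact (summable_remainderTerm_one hz).hasSum.tendsto_sum_nat
  | succ m hm ih =>
    have h := (ih.sub_const (T (m + 1) z)).add (tendsto_T_add_natCast m.succ_ne_zero z)
    rw [add_zero, R_succ m.succ_ne_zero z, add_sub_cancel_left] at h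
    refine h.congr fun N => ?_
    have h2 := Finset.sum_range_sub' (fun n : ℕ => T (m + 1) (z + n)) N
    rw [Nat.cast_zero, add_zero] at h2
    rw [Finset.sum_congr rfl fun n _ => remainderTerm_succ (Nat.one_le_iff_ne_zero.mp hm)
      (add_natCast_mem_slitPlane hz n), Finset.sum_sub_distrib]
    simp only [Nat.cast_succ, ← add_assoc] at h2
    rw [h2]
    ring

/-! ### Bounds in the closed right half plane -/

/-- The primitive of `(1 + t²)⁻³` that vanishes at `0`. -/
noncomputable def wallisPrimitive (t : ℝ) : ℝ :=
  t / (4 * (1 + t ^ 2) ^ 2) + 3 * t / (8 * (1 + t ^ 2)) +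
      3 / 8 * Real.arctan t

theorem hasDerivAt_wallisPrimitive (t : ℝ) :
    HasDerivAt wallisPrimitive (1 / (1 + t ^ 2) ^ 3) t := by
  have h0 : 1 + t ^ 2 ≠ 0 := by positivity
  have d0 : HasDerivAt (fun t : ℝ => 1 + t ^ 2) (2 * t) t := by
    simpa using (hasDerivAt_pow 2 t).const_add 1
  have d1 := (hasDerivAt_id t).div ((d0.pow 2).const_mul 4) (by simp [h0])
  have d2 := ((hasDerivAt_id t).const_mul 3).div (d0.const_mul 8) (by simp [h0])
  have d3 := (Real.hasDerivAt_arctan t).const_mul (3 / 8)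
  convert! (d1.add d2).add d3 using 1
  simp
  field_simp
  ring

/-- The right-hand side is the integral of `(1 + t²)⁻³` over `[0, ∞)`. -/
theorem wallisPrimitive_le (t : ℝ) : wallisPrimitive t ≤ 3 * Real.pi / 16 := by
  have hmono := monotone_of_deriv_nonneg (f := wallisPrimitive)
    (fun t => (hasDerivAt_wallisPrimitive t).differentiableAt)
    (fun t => by rw [(hasDerivAt_wallisPrimitive t).deriv]; positivity)
  have hlim : Tendsto (fun V : ℝ => 1 / V + 3 * Real.pi / 16) atTop (𝓝 (3 * Real.pi / 16)) := by
    simpa using (tendsto_inv_atTop_zero (𝕜 := ℝ)).add_const (3 * Real.pi / 16)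
  refine ge_of_tendsto hlim ?_
  filter_upwards [eventually_ge_atTop t, eventually_gt_atTop 0] with V hV hV0
  refine (hmono hV).trans ?_
  have h1 : V / (4 * (1 + V ^ 2) ^ 2) ≤ 1 / (4 * V) := by
    rw [div_le_div_iff₀ (by positivity) (by positivity)]; nlinarith [sq_nonneg (V ^ 2)]
  have h2 : 3 * V / (8 * (1 + V ^ 2)) ≤ 3 / (8 * V) := by
    rw [div_le_div_iff₀ (by positivity) (by positivity)]; nlinarith
  have h3 := Real.arctan_lt_pi_div_two V
  have h4 : 1 / (4 * V) + 3 / (8 * V) ≤ 1 / V := by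
    rw [div_add_div _ _ (by positivity) (by positivity), div_le_div_iff₀ (by positivity) hV0]
    nlinarith [pow_pos hV0 2]
  rw [wallisPrimitive]
  linarith

theorem sq_add_sq_le_norm_sq {z : ℂ} (hz : 0 ≤ z.re) {v : ℝ} (hv : 0 ≤ v) :
    ‖z‖ ^ 2 + v ^ 2 ≤ ‖(v : ℂ) + z‖ ^ 2 := by
  rw [← normSq_eq_norm_sq, ← normSq_eq_norm_sq, normSq_apply, normSq_apply]
  simp only [add_re, ofReal_re, add_im, ofReal_im, zero_add]
  nlinarith [mul_nonneg hz hv]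

/-- The primitive of `(r² + v²)⁻³` that vanishes at `0`, for `r > 0`. -/
noncomputable def wallisScaled (r v : ℝ) : ℝ :=
  wallisPrimitive (v / r) / r ^ 5

theorem hasDerivAt_wallisScaled {r : ℝ} (hr : 0 < r) (v : ℝ) :
    HasDerivAt (wallisScaled r) (1 / (r ^ 2 + v ^ 2) ^ 3) v := by
  have h := ((hasDerivAt_wallisPrimitive (v / r)).comp v ((hasDerivAt_id v).div_const r)).div_const
    (r ^ 5)
  convert! h using 1
  have : r ^ 2 + v ^ 2 ≠ 0 := by positivity
  have : 1 + (v / r) ^ 2 = (r ^ 2 + v ^ 2) / r ^ 2 := by field_simp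
  rw [this]
  field_simp

theorem norm_remainderTerm_add_natCast_le {m : ℕ} (hm : 3 ≤ m) {z : ℂ} (hz : z ≠ 0)
    (hre : 0 ≤ z.re) (n : ℕ) :
    ‖remainderTerm m (z + n)‖ ≤ |((bernoulli (2 * m) : ℚ) : ℝ)| / (2 * m) / ‖z‖ ^ (2 * (m - 3)) *
      (wallisScaled ‖z‖ (n + 1 : ℕ) - wallisScaled ‖z‖ n) := by
  have hr := norm_pos_iff.mpr hz
  set c := |((bernoulli (2 * m) : ℚ) : ℝ)| / (2 * m) / ‖z‖ ^ (2 * (m - 3)) with hc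
  have hcont : Continuous fun u : ℝ => c * (1 / (‖z‖ ^ 2 + (u + n) ^ 2) ^ 3) := by
    refine continuous_const.mul (continuous_const.div (by fun_prop) fun u => ?_)
    positivity
  have hint := intervalIntegral.integral_eq_sub_of_hasDerivAt (a := 0) (b := 1)
    (f := fun u : ℝ => c * wallisScaled ‖z‖ (u + n))
    (f' := fun u : ℝ => c * (1 / (‖z‖ ^ 2 + (u + n) ^ 2) ^ 3))
    (fun u _ => by
      simpa using ((hasDerivAt_wallisScaled hr (u + n)).comp u
        ((hasDerivAt_id u).add_const (n : ℝ))).const_mul c)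
    (hcont.intervalIntegrable _ _)
  have h := intervalIntegral.norm_integral_le_of_norm_le (μ := MeasureTheory.volume)
    (a := 0) (b := 1)
    (f := fun u : ℝ => -((bernoulliFun (2 * m) u : ℝ) : ℂ) / (2 * m * (u + (z + n)) ^ (2 * m)))
    (g := fun u : ℝ => c * (1 / (‖z‖ ^ 2 + (u + n) ^ 2) ^ 3)) zero_le_one
    (Eventually.of_forall fun u hu => ?_) (hcont.intervalIntegrable _ _)
  · refine h.trans (le_of_eq ?_)
    rw [hint]
    push_cast
    rw [zero_add, add_comm (n : ℝ), mul_sub]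
  · have hu' : u ∈ Set.Icc (0 : ℝ) 1 := ⟨hu.1.le, hu.2⟩
    refine (norm_remainderTerm_integrand_le (by omega) (z + n) hu').trans ?_
    have h0 : 0 ≤ u + n := by have := hu.1; positivity
    have h1 := sq_add_sq_le_norm_sq hre h0
    rw [show (u : ℂ) + (z + n) = ((u + n : ℝ) : ℂ) + z by push_cast; ring, hc,
      ← mul_one_div _ (_ ^ (2 * (m - 3))), mul_assoc, one_div_mul_one_div]
    refine mul_le_mul_of_nonneg_left (one_div_le_one_div_of_le (by positivity) ?_) (by positivity)
    rw [show 2 * m = 2 * (m - 3) + 2 * 3 by omega, pow_add, pow_mul, pow_mul,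
      pow_mul ‖((u + n : ℝ) : ℂ) + z‖ 2 3]
    have h2 : ‖z‖ ^ 2 ≤ ‖((u + n : ℝ) : ℂ) + z‖ ^ 2 := by nlinarith
    gcongr

/-- Of the exponent `2m` in `|z + v|^{-2m}`, the part `2m - 6` is estimated by `|z + v| ≥ |z|`; the
remaining integral of `(|z|² + v²)⁻³` gives the factor `3π/16`. -/
theorem norm_R_succ_le {m : ℕ} (hm : 3 ≤ m) {z : ℂ} (hz : z ≠ 0) (hre : 0 ≤ z.re) :
    ‖R (m + 1) z‖ ≤ (2 * m - 1) * (3 * Real.pi / 16) * ‖T m z‖ := by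
  have hr := norm_pos_iff.mpr hz
  have hm' : (3 : ℝ) ≤ m := by exact_mod_cast hm
  have hs : z ∈ slitPlane := by
    rw [mem_slitPlane_iff]
    by_contra! h
    exact hz (Complex.ext (le_antisymm h.1 hre) h.2)
  refine le_of_tendsto (tendsto_sum_remainderTerm (by omega) hs).norm
    (Eventually.of_forall fun N => ?_)
  refine (norm_sum_le_of_le _ fun n _ => norm_remainderTerm_add_natCast_le hm hz hre n).trans ?_
  rw [← Finset.mul_sum, Finset.sum_range_sub (fun n : ℕ => wallisScaled ‖z‖ n)]
  have h1 : wallisScaled ‖z‖ N ≤ (3 * Real.pi / 16) / ‖z‖ ^ 5 := by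
    unfold wallisScaled
    gcongr
    exact wallisPrimitive_le _
  have h2 : wallisScaled ‖z‖ (0 : ℕ) = 0 := by simp [wallisScaled, wallisPrimitive]
  rw [h2, sub_zero]
  refine (mul_le_mul_of_nonneg_left h1 (by positivity)).trans (le_of_eq ?_)
  have h3 : (2 * (m : ℝ) - 1) ≠ 0 := by linarith
  rw [norm_T (by omega), show 2 * m - 1 = 2 * (m - 3) + 5 by omega, pow_add]
  field_simp

end Remainder

/-! ### Numerical analysis of the recursion -/

theorem inv_pi_sq_bounds : 0.1013 < 1 / Real.pi ^ 2 ∧ 1 / Real.pi ^ 2 < 0.10133 := by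
  have h1 := Real.pi_gt_d4
  have h2 := Real.pi_lt_d4
  constructor
  · rw [lt_div_iff₀ (by positivity)]; nlinarith
  · rw [div_lt_iff₀ (by positivity)]; nlinarith

/-- The result of `n` steps of the recursion `b j = 1 + q j (j - 1/2) / k² · b (j + 1)`, where
`q = 0.10133 > π⁻²`, started at `1 + 0.5891 (2j - 1)`, where `0.5891 > 3π/16`. It has rational
values so that it can be evaluated for small `k`. -/
def ratioBound (k : ℚ) : ℕ → ℚ → ℚ
  | 0, j => 1 + 0.5891 * (2 * j - 1)
  | n + 1, j => 1 + 0.10133 * (j * (j - 1 / 2) / k ^ 2) * ratioBound k n (j + 1)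

theorem le_ratioBound {s : ℕ → ℝ} {k : ℕ} (hs : ∀ j, 0 ≤ s j)
    (hrec : ∀ j, 3 ≤ j → s j ≤ 1 + j * (j - 1 / 2) / (Real.pi ^ 2 * k ^ 2) * s (j + 1))
    (hdir : ∀ j, 3 ≤ j → s j ≤ 1 + (2 * j - 1) * (3 * Real.pi / 16)) (n : ℕ) :
    ∀ j, 3 ≤ j → s j ≤ ratioBound k n j := by
  induction n with
  | zero =>
    intro j hj
    have h3 : (3 : ℝ) ≤ j := by exact_mod_cast hj
    have hpi : 3 * Real.pi / 16 ≤ 0.5891 := by linarith [Real.pi_lt_d4]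
    refine (hdir j hj).trans ?_
    simp only [ratioBound]
    push_cast
    nlinarith
  | succ n ih =>
    intro j hj
    have h3 : (3 : ℝ) ≤ j := by exact_mod_cast hj
    have h := ih (j + 1) (by omega)
    push_cast at h
    have hq := inv_pi_sq_bounds
    refine (hrec j hj).trans ?_
    simp only [ratioBound]
    push_cast
    have e : (j : ℝ) * (j - 1 / 2) / (Real.pi ^ 2 * k ^ 2) =
      1 / Real.pi ^ 2 * (j * (j - 1 / 2) / k ^ 2) := by
      rw [div_mul_div_comm, one_mul]
    rw [e]
    have h4 : (0 : ℝ) ≤ j * (j - 1 / 2) / k ^ 2 :=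
      div_nonneg (mul_nonneg (by linarith) (by linarith)) (by positivity)
    have := hs (j + 1)
    gcongr
    exact hq.2.le

theorem pi_sq_div_bounds : 1.1127 < Real.pi ^ 2 / (Real.pi ^ 2 - 1) ∧
    Real.pi ^ 2 / (Real.pi ^ 2 - 1) < 1.1128 := by
  have h1 := Real.pi_gt_d4
  have h2 := Real.pi_lt_d4
  have h3 : 0 < Real.pi ^ 2 - 1 := by nlinarith
  constructor
  · rw [lt_div_iff₀ h3]; nlinarith
  · rw [div_lt_iff₀ h3]; nlinarith

theorem six_mul_sq_le_pow {k : ℕ} (hk : 10 ≤ k) : (6 : ℝ) * k ^ 2 ≤ 0.1 * 2.4 ^ k := by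
  induction k, hk using Nat.le_induction with
  | base => norm_num
  | succ k hk ih =>
    have h : (10 : ℝ) ≤ k := by exact_mod_cast hk
    rw [pow_succ (2.4 : ℝ)]
    push_cast
    nlinarith

/-- The inequality that the coefficients `0.4` and `0.25` of the majorant have to satisfy. For
`t ≤ 0.2` it is used that `h ≤ t`, and for larger `t` that `h ≤ 0.1`. -/
theorem polynomial_margin {t h : ℝ} (ht : h ≤ t) (ht1 : t ≤ 1 - h) (hh : 0 < h) (hh1 : h ≤ 0.1) :
    0.10133 * (1 + t) ^ 2 * (0.4 * (t + h) + 0.25 * (t + h) ^ 2) +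
      0.1128 * (2 * t + t ^ 2) ≤ 0.4 * t + 0.25 * t ^ 2 := by
  have ht0 : 0 < t := hh.trans_le ht
  rcases le_total t 0.2 with h2 | h2
  · have : 0.4 * (t + h) + 0.25 * (t + h) ^ 2 ≤ t * (0.8 + t) := by nlinarith
    have : (1 + t) ^ 2 * (0.4 * (t + h) + 0.25 * (t + h) ^ 2) ≤ 1.44 * (t * (0.8 + t)) := by
      gcongr ?_ * ?_
      nlinarith
    nlinarith
  · have : 0.4 * (t + h) + 0.25 * (t + h) ^ 2 ≤ 0.4 * (t + 0.1) + 0.25 * (t + 0.1) ^ 2 := by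
      gcongr
    have : (1 + t) ^ 2 * (0.4 * (t + h) + 0.25 * (t + h) ^ 2) ≤
        (1 + t) ^ 2 * (0.4 * (t + 0.1) + 0.25 * (t + 0.1) ^ 2) := by gcongr
    have hQ := mul_nonneg (sub_nonneg.2 h2) (by linarith : 0 ≤ 1 - t)
    have hQ1 := mul_nonneg hQ ht0.le
    have hQ2 := mul_nonneg hQ1 ht0.le
    -- the quartic in `t` is a positive combination of `Q`, `Q t`, `Q t²` and a positive linear
    -- function, where `Q = (t - 0.2) (1 - t)`
    nlinarith only [this, hQ2, hQ1, hQ, h2, ht1, hh]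

/-- One step of the recursion, with `q = π⁻²`, `h = 1/k`, `t = i/k` and `P = 1/(1 - q)`, maps the
majorant `P + 0.4 t + 0.25 t² + E` at `t + h` (where `E` is `2.4` times larger) below the
majorant at `t`. Here `P` is the fixed point for `t = h = 0`, the polynomial absorbs the growth
of the coefficient with `t`, and `2.4` is admissible because `4 q · 2.4 < 1`. -/
theorem supersolution_step {q P t h E : ℝ} (hq0 : 0 < q) (hq : q < 0.10133) (hP : P = 1 + q * P)
    (hP1 : P < 1.1128) (hP0 : 0 < P) (ht : h ≤ t) (ht1 : t ≤ 1 - h) (hh : 0 < h) (hh1 : h ≤ 0.1)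
    (hE : 0 ≤ E) :
    1 + q * ((1 + t) * (1 + t - h / 2)) * (P + 0.4 * (t + h) + 0.25 * (t + h) ^ 2 + 2.4 * E) ≤
      P + 0.4 * t + 0.25 * t ^ 2 + E := by
  have ht0 : 0 < t := hh.trans_le ht
  have hX : 0 ≤ 0.4 * (t + h) + 0.25 * (t + h) ^ 2 := by positivity
  have hS : 0 ≤ P + 0.4 * (t + h) + 0.25 * (t + h) ^ 2 + 2.4 * E := by positivity
  have h1 : q * ((1 + t) * (1 + t - h / 2)) ≤ q * (1 + t) ^ 2 := by
    gcongr; nlinarith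
  have h2 : q * (1 + t) ^ 2 ≤ 0.10133 * (1 + t) ^ 2 := by gcongr
  have h3 := mul_le_mul_of_nonneg_right h1 hS
  have h4 : 0.10133 * (1 + t) ^ 2 * 2.4 ≤ 1 := by nlinarith
  have h5 : q * (1 + t) ^ 2 * (2.4 * E) ≤ E := by nlinarith
  have h6 : q * (1 + t) ^ 2 * (0.4 * (t + h) + 0.25 * (t + h) ^ 2) ≤
      0.10133 * (1 + t) ^ 2 * (0.4 * (t + h) + 0.25 * (t + h) ^ 2) := by gcongr
  have h7 : q * P ≤ 0.1128 := by nlinarith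
  have h8 : q * P * (2 * t + t ^ 2) ≤ 0.1128 * (2 * t + t ^ 2) := by
    have : 0 ≤ 2 * t + t ^ 2 := by nlinarith
    gcongr
  have h9 := polynomial_margin ht ht1 hh hh1
  generalize q * ((1 + t) * (1 + t - h / 2)) = A at *
  linear_combination h3 + h5 + h6 + h8 + h9 - hP

/-- Descending from `j = 2k`, where the linear bound is at most `2.5 k`, down to `j = k + 1`, the
last term of the majorant shrinks geometrically. The index `n = k - i` counts the steps. -/
theorem le_supersolution {s : ℕ → ℝ} {k : ℕ} (hk : 10 ≤ k)
    (hrec : ∀ j, 3 ≤ j → s j ≤ 1 + j * (j - 1 / 2) / (Real.pi ^ 2 * k ^ 2) * s (j + 1))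
    (hdir : ∀ j, 3 ≤ j → s j ≤ 1 + (2 * j - 1) * (3 * Real.pi / 16)) (n : ℕ) :
    ∀ i : ℕ, 1 ≤ i → i + n = k → s (k + i) ≤ Real.pi ^ 2 / (Real.pi ^ 2 - 1) + 0.4 * (i / k) +
      0.25 * (i / k) ^ 2 + 2.5 * k / 2.4 ^ n := by
  have hk' : (10 : ℝ) ≤ k := by exact_mod_cast hk
  have hP := pi_sq_div_bounds
  induction n with
  | zero =>
    intro i hi hin
    obtain rfl : i = k := by omega
    have hpi : 3 * Real.pi / 16 ≤ 0.5891 := by linarith [Real.pi_lt_d4]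
    refine (hdir (i + i) (by omega)).trans ?_
    rw [div_self (by positivity)]
    push_cast
    nlinarith
  | succ n ih =>
    intro i hi hin
    have hi' : (1 : ℝ) ≤ i := by exact_mod_cast hi
    have hin' : (i : ℝ) + 1 ≤ k := by exact_mod_cast (by omega : i + 1 ≤ k)
    have h := ih (i + 1) (by omega) (by omega)
    have hq := inv_pi_sq_bounds
    have hpi := Real.pi_gt_three
    have hd : Real.pi ^ 2 - 1 ≠ 0 := by nlinarith
    refine (hrec (k + i) (by omega)).trans (le_trans ?_ (supersolution_step (h := 1 / k)
      (q := 1 / Real.pi ^ 2) (P := Real.pi ^ 2 / (Real.pi ^ 2 - 1)) (by linarith) hq.2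
      (by field_simp; ring) hP.2 (by linarith) (by gcongr) ?_ (by positivity) ?_ (by positivity)))
    · have e : ((k + i : ℕ) : ℝ) * ((k + i : ℕ) - 1 / 2) / (Real.pi ^ 2 * k ^ 2) =
        1 / Real.pi ^ 2 * ((1 + i / k) * (1 + i / k - 1 / k / 2)) := by
        push_cast; field_simp
      have e2 : 2.4 * (2.5 * k / 2.4 ^ (n + 1)) = 2.5 * (k : ℝ) / 2.4 ^ n := by
        rw [pow_succ]; field_simp
      have e3 : (i : ℝ) / k + 1 / k = ((i + 1 : ℕ) : ℝ) / k := by push_cast; ring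
      rw [e, e2, e3]
      have : (0 : ℝ) ≤ 1 + i / k - 1 / k / 2 := by
        have : (1 : ℝ) / k ≤ i / k := by gcongr
        have : (0 : ℝ) ≤ 1 / k := by positivity
        linarith
      gcongr
      exact h
    · rw [le_sub_iff_add_le, ← add_div]; exact div_le_one_of_le₀ hin' (by positivity)
    · rw [div_le_iff₀ (by positivity)]; linarith

/-- The numerical core: with `s j = |R_j / T_j|` and `|z| ≥ k`, the factor `1 - 1/(2k)` coming from
`|T_{k+1} / T_k|` outweighs the excess of `s (k + 1)` over `π² / (π² - 1)`. -/
theorem one_sub_mul_lt {s : ℕ → ℝ} {k : ℕ} (hk : 3 ≤ k) (hs : ∀ j, 0 ≤ s j)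
    (hrec : ∀ j, 3 ≤ j → s j ≤ 1 + j * (j - 1 / 2) / (Real.pi ^ 2 * k ^ 2) * s (j + 1))
    (hdir : ∀ j, 3 ≤ j → s j ≤ 1 + (2 * j - 1) * (3 * Real.pi / 16)) :
    (1 - 1 / (2 * k)) * s (k + 1) < Real.pi ^ 2 / (Real.pi ^ 2 - 1) := by
  have hP := pi_sq_div_bounds
  rcases le_or_gt 10 k with h10 | h10
  · have h10' : (10 : ℝ) ≤ k := by exact_mod_cast h10
    have h := le_supersolution h10 hrec hdir (k - 1) 1 le_rfl (by omega)
    -- at `i = 1` the majorant exceeds `P` by at most `(0.4 + 0.025 + 0.1) / k`, which is less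
    -- than `P / (2k)`
    have h6 := six_mul_sq_le_pow h10
    have e : (2.4 : ℝ) ^ k = 2.4 * 2.4 ^ (k - 1) := by rw [← pow_succ']; congr 1; omega
    have h7 : 2.5 * (k : ℝ) / 2.4 ^ (k - 1) ≤ 0.1 * (1 / k) := by
      rw [mul_one_div, div_le_div_iff₀ (by positivity) (by positivity)]; linarith
    have h8 : (1 : ℝ) / k ≤ 0.1 := by rw [div_le_iff₀ (by positivity)]; linarith
    have h9 : (0 : ℝ) < 1 / k := by positivity
    push_cast at h
    rw [show (1 : ℝ) / (2 * k) = 1 / k / 2 by field_simp]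
    generalize (1 : ℝ) / k = x at *
    have : s (k + 1) ≤ Real.pi ^ 2 / (Real.pi ^ 2 - 1) + 0.525 * x := by nlinarith
    nlinarith
  · have h := fun n => le_ratioBound hs hrec hdir n (k + 1) (by omega)
    have hk0 : (0 : ℝ) ≤ 1 - 1 / (2 * k) := by
      have : (3 : ℝ) ≤ k := by exact_mod_cast hk
      rw [sub_nonneg, div_le_one (by positivity)]; linarith
    -- starting the descent at `j = 2k + 4` is accurate enough for `3 ≤ k ≤ 9`
    refine (mul_le_mul_of_nonneg_left (h (k + 3)) hk0).trans_lt (lt_trans ?_ hP.1)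
    interval_cases k <;> norm_num [ratioBound]

/-! ### The quotient of remainder and term -/

theorem norm_R_div_T_le {j : ℕ} (hj : j ≠ 0) {z : ℂ} (hz : z ≠ 0) :
    ‖R j z / T j z‖ ≤ 1 + ‖R (j + 1) z / T j z‖ := by
  rw [R_succ hj z, add_div, div_self (T_ne_zero hj hz)]
  exact (norm_add_le _ _).trans (by simp)

theorem norm_R_succ_div_T_eq {j : ℕ} (hj : j ≠ 0) {z : ℂ} (hz : z ≠ 0) :
    ‖R (j + 1) z / T j z‖ = ‖T (j + 1) z‖ / ‖T j z‖ * ‖R (j + 1) z / T (j + 1) z‖ := by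
  have h1 := norm_pos_iff.mpr (T_ne_zero hj hz)
  have h2 := norm_pos_iff.mpr (T_ne_zero j.succ_ne_zero hz)
  rw [norm_div, norm_div]
  field_simp

theorem norm_T_succ_div_le {j : ℕ} (hj : j ≠ 0) {z : ℂ} (hz : z ≠ 0) :
    ‖T (j + 1) z‖ / ‖T j z‖ ≤ j * (j - 1 / 2) / (Real.pi ^ 2 * ‖z‖ ^ 2) :=
  (div_le_iff₀ (norm_pos_iff.mpr (T_ne_zero hj hz))).mpr (norm_T_succ_le hj hz)

theorem norm_R_div_T_rec {k j : ℕ} (hk : 1 ≤ k) (hj : j ≠ 0) {z : ℂ} (hz : z ≠ 0)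
    (hkz : (k : ℝ) ≤ ‖z‖) :
    ‖R j z / T j z‖ ≤
      1 + j * (j - 1 / 2) / (Real.pi ^ 2 * k ^ 2) * ‖R (j + 1) z / T (j + 1) z‖ := by
  have h1 : (1 : ℝ) ≤ j := by exact_mod_cast Nat.one_le_iff_ne_zero.mpr hj
  have h2 : (0 : ℝ) ≤ j * (j - 1 / 2) := mul_nonneg (by linarith) (by linarith)
  have h3 : (0 : ℝ) < k := by exact_mod_cast hk
  refine (norm_R_div_T_le hj hz).trans ?_
  rw [norm_R_succ_div_T_eq hj hz]
  refine add_le_add_right (mul_le_mul_of_nonneg_right ((norm_T_succ_div_le hj hz).trans ?_)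
    (norm_nonneg _)) 1
  gcongr

theorem norm_R_div_T_direct {j : ℕ} (hj : 3 ≤ j) {z : ℂ} (hz : z ≠ 0) (hre : 0 ≤ z.re) :
    ‖R j z / T j z‖ ≤ 1 + (2 * j - 1) * (3 * Real.pi / 16) := by
  refine (norm_R_div_T_le (by omega) hz).trans ?_
  rw [norm_div]
  gcongr
  exact (div_le_iff₀ (norm_pos_iff.mpr (T_ne_zero (by omega) hz))).mpr (norm_R_succ_le hj hz hre)

/-- For `k ≤ 2` the ratios `T_2 / T_1` and `T_3 / T_2` are needed exactly, since the estimate of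
`|T_{j+1} / T_j|` by `ζ (2j + 2) ≤ ζ (2j)` is too lossy there. -/
theorem norm_R_succ_div_T_lt {k : ℕ} (hk : 1 ≤ k) {z : ℂ} (hz : z ≠ 0) (hre : 0 ≤ z.re)
    (hkz : (k : ℝ) ≤ ‖z‖) :
    ‖R (k + 1) z / T k z‖ < ((k : ℝ) / ‖z‖) ^ 2 / (Real.pi ^ 2 - 1) := by
  have hr := norm_pos_iff.mpr hz
  have hP := pi_sq_div_bounds
  have hpi : 0 < Real.pi ^ 2 - 1 := by nlinarith [Real.pi_gt_three]
  have hinv : 0.1127 < 1 / (Real.pi ^ 2 - 1) := by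
    have : Real.pi ^ 2 / (Real.pi ^ 2 - 1) = 1 + 1 / (Real.pi ^ 2 - 1) := by field_simp; ring
    linarith [hP.1]
  have hrec := fun j (hj : 3 ≤ j) => norm_R_div_T_rec (j := j) hk (by omega) hz hkz
  have hdir := fun j (hj : 3 ≤ j) => norm_R_div_T_direct hj hz hre
  have hs : ∀ j, 0 ≤ ‖R j z / T j z‖ := fun j => norm_nonneg _
  rw [norm_R_succ_div_T_eq (by omega) hz]
  have hT1 := norm_pos_iff.mpr (T_ne_zero one_ne_zero hz)
  have hT2 := norm_pos_iff.mpr (T_ne_zero two_ne_zero hz)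
  have hT32 : ‖T (2 + 1) z‖ / ‖T 2 z‖ = 2 / 7 / ‖z‖ ^ 2 := by
    rw [norm_T_three, mul_div_assoc, div_self hT2.ne', mul_one]
  have hb := fun n j (hj : 3 ≤ j) => le_ratioBound hs hrec hdir n j hj
  obtain rfl | rfl | h3 : k = 1 ∨ k = 2 ∨ 3 ≤ k := by omega
  · have h3 := hb 0 3 le_rfl
    have h2 := norm_R_div_T_le two_ne_zero hz
    rw [norm_R_succ_div_T_eq two_ne_zero hz, hT32] at h2
    rw [norm_T_two, mul_div_assoc, div_self hT1.ne', mul_one, div_pow, ← mul_one_div _ (_ - _),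
      div_mul_eq_mul_div, div_mul_eq_mul_div, div_mul_eq_mul_div]
    refine div_lt_div_of_pos_right ?_ (by positivity)
    norm_num [ratioBound] at h3 hkz hinv ⊢
    have h4 : 2 / 7 / ‖z‖ ^ 2 ≤ 2 / 7 := div_le_self (by norm_num) (one_le_pow₀ hkz)
    have h5 := mul_le_mul h4 h3 (by positivity) (by norm_num)
    norm_num at h2 h5
    linarith
  · have h3 := hb 3 3 le_rfl
    rw [hT32, div_pow, ← mul_one_div _ (_ - _), div_mul_eq_mul_div,
      div_mul_eq_mul_div, div_mul_eq_mul_div]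
    refine div_lt_div_of_pos_right ?_ (by positivity)
    norm_num [ratioBound] at h3 hinv ⊢
    linarith
  · have h := one_sub_mul_lt h3 hs hrec hdir
    have hk0 : (0 : ℝ) < k := by exact_mod_cast hk
    refine (mul_le_mul_of_nonneg_right (norm_T_succ_div_le (by omega) hz) (hs _)).trans_lt ?_
    have e1 : (k : ℝ) * (k - 1 / 2) / (Real.pi ^ 2 * ‖z‖ ^ 2) * ‖R (k + 1) z / T (k + 1) z‖ =
        (k / ‖z‖) ^ 2 / Real.pi ^ 2 * ((1 - 1 / (2 * k)) * ‖R (k + 1) z / T (k + 1) z‖) := by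
      field_simp
    have e2 : ((k : ℝ) / ‖z‖) ^ 2 / (Real.pi ^ 2 - 1) =
        (k / ‖z‖) ^ 2 / Real.pi ^ 2 * (Real.pi ^ 2 / (Real.pi ^ 2 - 1)) := by
      field_simp
    rw [e1, e2]
    gcongr

end GammaStirling

theorem mainTheorem3 (k : ℕ) (hk : 1 ≤ k) (z : ℂ) (hz0 : z ≠ 0) (hre : 0 ≤ z.re)
    (hkz : (k : ℝ) ≤ ‖z‖) :
    (‖GammaStirling.R (k + 1) z / GammaStirling.T k z‖ < ((k : ℝ) / ‖z‖) ^ 2 / (Real.pi ^ 2 - 1) ∧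
      ((k : ℝ) / ‖z‖) ^ 2 / (Real.pi ^ 2 - 1) ≤ 1 / (Real.pi ^ 2 - 1) ∧
      1 / (Real.pi ^ 2 - 1) < 0.113) ∧
    (‖GammaStirling.R k z / GammaStirling.T k z‖ <
        1 + ((k : ℝ) / ‖z‖) ^ 2 / (Real.pi ^ 2 - 1) ∧
      1 + ((k : ℝ) / ‖z‖) ^ 2 / (Real.pi ^ 2 - 1) ≤ Real.pi ^ 2 / (Real.pi ^ 2 - 1) ∧
      Real.pi ^ 2 / (Real.pi ^ 2 - 1) < 1.113) := by
  have hpi : 0 < Real.pi ^ 2 - 1 := by nlinarith [Real.pi_gt_three]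
  have hP := GammaStirling.pi_sq_div_bounds
  have e : Real.pi ^ 2 / (Real.pi ^ 2 - 1) = 1 + 1 / (Real.pi ^ 2 - 1) := by field_simp; ring
  have h1 := GammaStirling.norm_R_succ_div_T_lt hk hz0 hre hkz
  have h2 : ((k : ℝ) / ‖z‖) ^ 2 / (Real.pi ^ 2 - 1) ≤ 1 / (Real.pi ^ 2 - 1) := by
    gcongr
    exact pow_le_one₀ (by positivity) (div_le_one_of_le₀ hkz (norm_nonneg z))
  have h3 := GammaStirling.norm_R_div_T_le (Nat.one_le_iff_ne_zero.mp hk) hz0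
  refine ⟨⟨h1, h2, by linarith⟩, by linarith, by linarith, by linarith⟩
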